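/- For $n\ge 1$ let $\Omega_n=\{0,1,-1,\dots,n,-n\}$, and let $\mathfrak{B}_n$ be the group of signed permutations, i.e. bijections $\pi:\Omega_n\to\Omega_n$ with $\pi(-a)=-\pi(a)$ for all $a\in\Omega_n$ (so $\pi(0)=0$); write $\pi_i=\pi(i)$. Let $<_r$ be the total order on $\mathbb{Z}$ given by $$-1<_r-2<_r-3<_r\cdots<_r0<_r1<_r2<_r\cdots$$ and let $\operatorname{des}_B(\pi)=\#\{i\in\{0,1,\dots,n-1\} : \pi_i>_r\pi_{i+1}\}$. A fixed-point free signed involution is a $\pi\in\mathfrak{B}_n$ with $\pi^{-1}=\pi$ and $\pi(i)\ne i$, $\pi(i)\ne -i$ for every $i\in\{1,\dots,n\}$. For $k\in\mathbb{Z}$ let $J^{\underline{B}}_{n,k}$ be the number of fixed-point free signed involutions $\pi\in\mathfrak{B}_n$ with $\operatorname{des}_B(\pi)=k$. **Theorem.** For all integers $n\ge 2$ and $k\ge 0$, $$\begin{aligned} n J^{\underline{B}}_{2n,k}={}&(k^2+n-1)\,J^{\underline{B}}_{2n-2,k}+\bigl(2(k-1)(2n-k)+1\bigr)J^{\underline{B}}_{2n-2,k-1}\\&+\bigl((k-2)(k-4n)+4n^2-3n\bigr)J^{\underline{B}}_{2n-2,k-2},\end{aligned}$$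 and $J^{\underline{B}}_{2,0}=0$, $J^{\underline{B}}_{2,1}=1$, $J^{\underline{B}}_{2,2}=1$, and $J^{\underline{B}}_{2n,k}=0$ for all $n\ge 1$ and $k<0$. -/

import Mathlib

namespace SignedInvolution

/-- The set `Ω_n = {0, 1, -1, …, n, -n}`. -/
abbrev Omega (n : ℕ) : Type := {a : ℤ // -(n : ℤ) ≤ a ∧ a ≤ n}

/-- The map `a ↦ -a` on `Ω_n`. -/
def Omega.opp {n : ℕ} (a : Omega n) : Omega n :=
  ⟨-a.1, by have h := a.2; omega⟩

/-- The element `i` of `Ω_n`, for `0 ≤ i ≤ n`. -/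
def Omega.ofIndex {n : ℕ} (i : Fin (n + 1)) : Omega n :=
  ⟨(i : ℤ), by have h := i.2; omega⟩

/-- The hyperoctahedral group `𝔅_n`: the bijections `π` of `Ω_n` with `π(-a) = -π(a)`. -/
def hyperoctahedral (n : ℕ) : Subgroup (Equiv.Perm (Omega n)) where
  carrier := {π | ∀ a, π a.opp = (π a).opp}
  mul_mem' := by
    intro σ τ hσ hτ a
    rw [Equiv.Perm.mul_apply, Equiv.Perm.mul_apply, hτ a, hσ (τ a)]
  one_mem' := fun _ => rfl
  inv_mem' := by
    intro σ hσ a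
    apply σ.injective
    rw [hσ (σ⁻¹ a)]
    simp

/-- The strict `r`-order on `ℤ`: `-1 <_r -2 <_r ⋯ <_r 0 <_r 1 <_r 2 <_r ⋯`. -/
def rLT (a b : ℤ) : Prop :=
  (a < 0 ∧ 0 ≤ b) ∨ (a < 0 ∧ b < 0 ∧ b < a) ∨ (0 ≤ a ∧ 0 ≤ b ∧ a < b)

instance (a b : ℤ) : Decidable (rLT a b) := by unfold rLT; infer_instance

/-- The letter `π_i = π(i)`, for `0 ≤ i ≤ n`. -/
def letter {n : ℕ} (π : hyperoctahedral n) (i : Fin (n + 1)) : ℤ :=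
  (π.1 (Omega.ofIndex i)).1

/-- The set of indices `i ∈ {0, …, n - 1}` with `π_i >_r π_{i+1}`. -/
def rDescents {n : ℕ} (π : hyperoctahedral n) : Finset (Fin n) :=
  Finset.univ.filter fun i => rLT (letter π i.succ) (letter π i.castSucc)

/-- The number of descents of `π` under the `r`-order. -/
def rDes {n : ℕ} (π : hyperoctahedral n) : ℕ := (rDescents π).card

/-- `π` is a fixed-point free signed involution: `π⁻¹ = π`, and `π(i) ≠ i`, `π(i) ≠ -i` for all
`1 ≤ i ≤ n`. -/
def IsFixedPointFreeInvolution {n : ℕ} (π : hyperoctahedral n) : Prop :=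
  π⁻¹ = π ∧
    ∀ i : Fin (n + 1), 1 ≤ (i : ℕ) → letter π i ≠ (i : ℤ) ∧ letter π i ≠ -(i : ℤ)

/-- The number `J_{n,k}` of fixed-point free signed involutions in `𝔅_n` with exactly `k` descents
under the `r`-order; the index `k` is any integer. -/
noncomputable def J (n : ℕ) (k : ℤ) : ℕ :=
  Set.ncard {π : hyperoctahedral n | IsFixedPointFreeInvolution π ∧ (rDes π : ℤ) = k}

end SignedInvolution

namespace SignedInvolution

open Finset

/-! The proof is a P-partition argument. An involution with descent set `D` admits `C(m - |D| + 2n,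
2n)` chains `0 = F 0 ≤ ⋯ ≤ F (2n) ≤ m` that increase strictly at descents (`card_strictChain`).
Giving position `i` the colour `2 F i - [π i < 0]` turns pairs (involution, chain) into weakly
increasing colourings by `0, …, 2m` whose parity records the sign, with `σ = |π|` increasing on each
colour class (`card_chains`). Such an object is determined by the multiset of pairs `(c i, c (σ
i))`, hence by `n` unordered pairs of distinct colours of equal parity (`card_colouredInvolution`).
There are `m²` such pairs, so `sum_J_mul_choose` gives `∑ k, J (2n) k * C(m - k + 2n, 2n) = C(m² + n
- 1, n)` for every `m`. The recurrence follows from `n C(m² + n - 1, n) = (m² + n - 1) C(m² + n - 2,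
n - 1)`: `choose_three_term` expands `(m² + n - 1) C(m - k + 2n - 2, 2n - 2)` in the binomials of
level `2n`, and coefficients are compared because the system in `m` is unitriangular. -/

/-! ### Sorted sequences and chains with prescribed strict steps. -/

theorem eq_of_monotone_of_map_univ_eq {α : Type*} [PartialOrder α] {N : ℕ} {f g : Fin N → α}
    (hf : Monotone f) (hg : Monotone g)
    (h : (univ : Finset (Fin N)).val.map f = (univ : Finset (Fin N)).val.map g) : f = g := by
  rw [Fin.univ_val_map, Fin.univ_val_map, Multiset.coe_eq_coe] at h
  exact List.ofFn_injective
    (h.eq_of_pairwise' hf.sortedLE_ofFn.pairwise hg.sortedLE_ofFn.pairwise)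

theorem exists_monotone_map_univ_eq {α : Type*} [LinearOrder α] (M : Multiset α) :
    ∃ f : Fin (Multiset.card M) → α, Monotone f ∧
      (univ : Finset (Fin (Multiset.card M))).val.map f = M := by
  obtain ⟨l, rfl⟩ := Quotient.exists_rep M
  refine ⟨l.get ∘ Tuple.sort l.get, Tuple.monotone_sort _, ?_⟩
  have h := (Tuple.sort l.get).ofFn_comp_perm l.get
  rw [List.ofFn_get] at h
  have h2 : (univ : Finset (Fin l.length)).val.map (l.get ∘ Tuple.sort l.get) = (l : Multiset α) := by
    rw [Fin.univ_val_map, Multiset.coe_eq_coe]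
    exact h
  exact h2

theorem card_monotone_fin (N M : ℕ) :
    Nat.card {f : Fin N → Fin M // Monotone f} = (M + N - 1).choose N := by
  have key : Nat.card {f : Fin N → Fin M // Monotone f} = Nat.card (Sym (Fin M) N) := by
    refine Nat.card_congr (Equiv.ofBijective
      (fun f => (⟨(univ : Finset (Fin N)).val.map f.1, by simp⟩ : Sym (Fin M) N)) ⟨?_, ?_⟩)
    · intro f g h
      exact Subtype.ext (eq_of_monotone_of_map_univ_eq f.2 g.2 (congrArg Subtype.val h))
    · rintro ⟨S, rfl⟩
      obtain ⟨f, hf, hS⟩ := exists_monotone_map_univ_eq S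
      exact ⟨⟨f, hf⟩, Subtype.ext hS⟩
  rw [key, Nat.card_eq_fintype_card, Sym.card_sym_eq_choose, Fintype.card_fin]

/-- The sequences `0 = F 0 ≤ F 1 ≤ ⋯ ≤ F N ≤ m` with `F i < F (i + 1)` for `i ∈ D`. -/
abbrev StrictChain {N : ℕ} (D : Finset (Fin N)) (m : ℕ) : Type :=
  {F : Fin (N + 1) → Fin (m + 1) //
    (F 0 : ℕ) = 0 ∧ ∀ i : Fin N, (F i.castSucc : ℕ) + (if i ∈ D then 1 else 0) ≤ F i.succ}

/-- The number of elements of `D` before position `j`. -/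
def countBefore {N : ℕ} (D : Finset (Fin N)) (j : Fin (N + 1)) : ℕ :=
  (D.filter fun x => x.castSucc < j).card

theorem countBefore_zero {N : ℕ} (D : Finset (Fin N)) : countBefore D 0 = 0 := by
  simp [countBefore]

theorem countBefore_le {N : ℕ} (D : Finset (Fin N)) (j : Fin (N + 1)) :
    countBefore D j ≤ D.card := card_filter_le _ _

theorem countBefore_last {N : ℕ} (D : Finset (Fin N)) : countBefore D (Fin.last N) = D.card := by
  simp [countBefore, Fin.castSucc_lt_last]

theorem countBefore_succ {N : ℕ} (D : Finset (Fin N)) (i : Fin N) :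
    countBefore D i.succ = countBefore D i.castSucc + (if i ∈ D then 1 else 0) := by
  have h : (D.filter fun x => x.castSucc < i.succ) =
      (D.filter fun x => x.castSucc < i.castSucc) ∪ D.filter fun x => x = i := by
    ext x
    simp only [mem_filter, mem_union, Fin.lt_def, Fin.val_castSucc, Fin.val_succ, Fin.ext_iff]
    grind
  unfold countBefore
  rw [h, card_union_of_disjoint]
  · congr 1
    by_cases hi : i ∈ D <;> simp [filter_eq', hi]
  · rw [disjoint_filter]
    rintro x - hx rfl
    exact lt_irrefl _ hx

/-- Subtracting from `F j` the number of forced strict steps before `j` leaves an arbitrary weakly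
increasing sequence with values at most `m - |D|`. -/
theorem card_strictChain {N : ℕ} (D : Finset (Fin N)) (m : ℕ) :
    Nat.card (StrictChain D m) = (m + 1 - D.card + N - 1).choose N := by
  rw [← card_monotone_fin]
  have hF : ∀ F : StrictChain D m,
      Monotone (fun j => ((F.1 j : ℕ) : ℤ) - countBefore D j) := by
    intro F
    refine Fin.monotone_iff_le_succ.2 fun i => ?_
    have := F.2.2 i
    rw [countBefore_succ]
    push_cast
    split_ifs at this ⊢ <;> omega
  have h0 : ∀ (F : StrictChain D m) j, countBefore D j ≤ F.1 j := by
    intro F j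
    have := hF F (Fin.zero_le j)
    simp only [countBefore_zero, F.2.1] at this
    omega
  have h1 : ∀ (F : StrictChain D m) j, (F.1 j : ℕ) - countBefore D j < m + 1 - D.card := by
    intro F j
    have := hF F (Fin.le_last j)
    have h2 := (F.1 (Fin.last N)).2
    have h3 := h0 F (Fin.last N)
    have h4 := h0 F j
    simp only [countBefore_last] at this h3
    omega
  refine Nat.card_congr (Equiv.ofBijective (fun F => ⟨fun i =>
    ⟨(F.1 i.succ : ℕ) - countBefore D i.succ, h1 F i.succ⟩, ?_⟩) ⟨?_, ?_⟩)
  · intro i j hij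
    have h := hF F (Fin.succ_le_succ_iff.2 hij)
    have h2 := h0 F i.succ
    have h3 := h0 F j.succ
    simp only [Fin.le_def] at h ⊢
    omega
  · intro F G h
    refine Subtype.ext (funext fun j => Fin.ext ?_)
    induction j using Fin.cases with
    | zero => rw [F.2.1, G.2.1]
    | succ i =>
      have h2 := congrArg Fin.val (congrFun (congrArg Subtype.val h) i)
      have h3 := h0 F i.succ
      have h4 := h0 G i.succ
      simp only at h2
      omega
  · rintro ⟨g, hg⟩
    have hb : ∀ i : Fin N, (g i : ℕ) + countBefore D i.succ < m + 1 := by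
      intro i
      have h1 := (g i).2
      have h2 := countBefore_le D i.succ
      omega
    refine ⟨⟨Fin.cons 0 fun i => ⟨(g i : ℕ) + countBefore D i.succ, hb i⟩, rfl, fun i => ?_⟩, ?_⟩
    · rw [Fin.cons_succ]
      change _ ≤ (g i : ℕ) + countBefore D i.succ
      rw [countBefore_succ D i]
      have : ((Fin.cons 0 fun i => ⟨(g i : ℕ) + countBefore D i.succ, hb i⟩ :
          Fin (N + 1) → Fin (m + 1)) i.castSucc : ℕ) ≤ (g i : ℕ) + countBefore D i.castSucc := by
        obtain ⟨i, hi⟩ := i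
        cases i with
        | zero => exact Nat.zero_le _
        | succ i =>
          have h5 : (⟨i + 1, hi⟩ : Fin N).castSucc = (⟨i, by omega⟩ : Fin N).succ := rfl
          rw [h5, Fin.cons_succ]
          have h6 : g ⟨i, by omega⟩ ≤ g ⟨i + 1, hi⟩ := hg (by simp [Fin.le_def])
          simp only [Fin.le_def] at h6 ⊢
          omega
      omega
    · refine Subtype.ext (funext fun i => Fin.ext ?_)
      simp

/-! ### Coloured involutions as multisets of colour pairs. -/

/-- Pairs of a fixed-point free involution `σ` of `Fin N` and a weakly increasing colouring `c`
such that `σ` preserves the parity of the colours and is increasing on each colour class. -/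
abbrev ColouredInvolution (N m : ℕ) : Type :=
  {p : Equiv.Perm (Fin N) × (Fin N → Fin (2 * m + 1)) //
    ((∀ i, p.1 (p.1 i) = i) ∧ (∀ i, p.1 i ≠ i)) ∧
    (∀ i, (p.2 (p.1 i) : ℕ) % 2 = p.2 i % 2) ∧ Monotone p.2 ∧
    ∀ i j, i < j → p.2 i = p.2 j → p.1 i < p.1 j}

/-- Pairs of colours `a < b` of the same parity. -/
abbrev ColourPair (m : ℕ) : Type :=
  {p : Fin (2 * m + 1) × Fin (2 * m + 1) // p.1 < p.2 ∧ (p.1 : ℕ) % 2 = p.2 % 2}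

/-- With `m + 1` even and `m` odd colours the count is `C(m+1, 2) + C(m, 2)`. In the bijection, `a ≤
b` encodes the even pair `2a < 2(b+1)` and `a > b` the odd pair `2b+1 < 2a+1`. -/
theorem card_colourPair (m : ℕ) : Fintype.card (ColourPair m) = m ^ 2 := by
  have e : Fin m × Fin m ≃ ColourPair m :=
    { toFun := fun p => if h : p.1 ≤ p.2 then
          ⟨(⟨2 * p.1, by omega⟩, ⟨2 * (p.2 + 1), by omega⟩), by
            simp only [Fin.lt_def, Fin.le_def] at *; omega⟩
        else
          ⟨(⟨2 * p.2 + 1, by omega⟩, ⟨2 * p.1 + 1, by omega⟩), by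
            simp only [Fin.lt_def, Fin.le_def] at *; omega⟩
      invFun := fun q => if h : (q.1.1 : ℕ) % 2 = 0 then
          (⟨q.1.1 / 2, by have := q.2; simp only [Fin.lt_def] at this; omega⟩,
            ⟨q.1.2 / 2 - 1, by have := q.2; simp only [Fin.lt_def] at this; omega⟩)
        else
          (⟨q.1.2 / 2, by have := q.2; simp only [Fin.lt_def] at this; omega⟩,
            ⟨q.1.1 / 2, by have := q.2; simp only [Fin.lt_def] at this; omega⟩)
      left_inv := by
        rintro ⟨a, b⟩
        by_cases h : a ≤ b
        · simp only [h, dite_true, Nat.mul_mod_right, Prod.mk.injEq, Fin.ext_iff]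
          omega
        · have : ¬ (2 * (b : ℕ) + 1) % 2 = 0 := by omega
          simp only [h, dite_false, this, Prod.mk.injEq, Fin.ext_iff]
          omega
      right_inv := by
        rintro ⟨⟨a, b⟩, h1, h2⟩
        simp only [Fin.lt_def] at h1 h2
        by_cases h : (a : ℕ) % 2 = 0
        · have h3 : (a : ℕ) / 2 ≤ b / 2 - 1 := by omega
          simp only [h, dite_true, Fin.mk_le_mk, h3, Subtype.mk.injEq, Prod.mk.injEq, Fin.ext_iff]
          omega
        · have h3 : ¬ (b : ℕ) / 2 ≤ a / 2 := by omega
          simp only [h, dite_false, Fin.mk_le_mk, h3, Subtype.mk.injEq, Prod.mk.injEq, Fin.ext_iff]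
          omega }
  rw [← Fintype.card_congr e]
  simp [sq]

/-- The multiset of pairs `(c i, c (σ i))`. -/
def pairMultiset {N m : ℕ} (x : ColouredInvolution N m) :
    Multiset (Fin (2 * m + 1) × Fin (2 * m + 1)) :=
  (univ : Finset (Fin N)).val.map fun i => (x.1.2 i, x.1.2 (x.1.1 i))

theorem pairMultiset_map_swap {N m : ℕ} (x : ColouredInvolution N m) :
    (pairMultiset x).map Prod.swap = pairMultiset x := by
  obtain ⟨⟨σ, c⟩, ⟨hσ, hfix⟩, hpar, hmono, hinc⟩ := x
  unfold pairMultiset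
  dsimp only at *
  rw [Multiset.map_map]
  conv_rhs => rw [← Finset.map_univ_equiv σ, Finset.map_val, Multiset.map_map]
  refine Multiset.map_congr rfl fun i _ => ?_
  simp [hσ]

/-- Within a colour class `σ` is increasing, so it cannot exchange two of its elements. -/
theorem colour_ne {N m : ℕ} (x : ColouredInvolution N m) (i : Fin N) :
    x.1.2 i ≠ x.1.2 (x.1.1 i) := by
  obtain ⟨⟨σ, c⟩, ⟨hσ, hfix⟩, hpar, hmono, hinc⟩ := x
  dsimp only at *
  intro h
  rcases lt_or_gt_of_ne (hfix i) with h1 | h1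
  · have := hinc _ _ h1 h.symm
    rw [hσ] at this
    exact lt_asymm this h1
  · have := hinc _ _ h1 h
    rw [hσ] at this
    exact lt_asymm this h1

theorem pairMultiset_mem {N m : ℕ} (x : ColouredInvolution N m) :
    ∀ p ∈ pairMultiset x, p.1 ≠ p.2 ∧ (p.1 : ℕ) % 2 = p.2 % 2 := by
  intro p hp
  obtain ⟨i, -, rfl⟩ := Multiset.mem_map.1 hp
  exact ⟨colour_ne x i, (x.2.2.1 i).symm⟩

theorem pair_monotone {N m : ℕ} (x : ColouredInvolution N m) :
    Monotone fun i => toLex (x.1.2 i, x.1.2 (x.1.1 i)) := by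
  intro i j hij
  rw [Prod.Lex.toLex_le_toLex]
  rcases (x.2.2.2.1 hij).lt_or_eq with h | h
  · exact Or.inl h
  · refine Or.inr ⟨h, x.2.2.2.1 ?_⟩
    rcases hij.lt_or_eq with h2 | rfl
    · exact (x.2.2.2.2 i j h2 h).le
    · exact le_rfl

/-- An involution increasing on colour classes is the stable sorting permutation of `c ∘ σ`. -/
theorem involution_eq_sort {N m : ℕ} (x : ColouredInvolution N m) :
    x.1.1 = Tuple.sort fun i => toLex (x.1.2 (x.1.1 i), x.1.2 i) := by
  rw [Tuple.eq_sort_iff]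
  have h := x.2.1.1
  refine ⟨?_, fun i j hij he => ?_⟩
  · have e : (fun i => toLex (x.1.2 (x.1.1 i), x.1.2 i)) ∘ x.1.1 =
        fun i => toLex (x.1.2 i, x.1.2 (x.1.1 i)) := by
      funext i
      simp only [Function.comp, h]
    rw [e]
    exact pair_monotone x
  · have := congrArg (fun p => (ofLex p).1) he
    simp only [ofLex_toLex, h] at this
    exact x.2.2.2.2 i j hij this

/-- The pairs `(c i, c (σ i))` already appear in lexicographic order, so the multiset determines `c`
and `c ∘ σ`; then `σ` is recovered by stable sorting. -/
theorem pairMultiset_injective (N m : ℕ) :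
    Function.Injective (pairMultiset : ColouredInvolution N m → _) := by
  intro x y h
  have h1 : (fun i => toLex (x.1.2 i, x.1.2 (x.1.1 i))) =
      fun i => toLex (y.1.2 i, y.1.2 (y.1.1 i)) := by
    refine eq_of_monotone_of_map_univ_eq (pair_monotone x) (pair_monotone y) ?_
    have := congrArg (Multiset.map toLex) h
    simpa only [pairMultiset, Multiset.map_map, Function.comp_def] using this
  have h2 : ∀ i, x.1.2 i = y.1.2 i ∧ x.1.2 (x.1.1 i) = y.1.2 (y.1.1 i) := fun i => by
    have := congrArg ofLex (congrFun h1 i)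
    simpa using this
  refine Subtype.ext (Prod.ext ?_ (funext fun i => (h2 i).1))
  rw [involution_eq_sort x, involution_eq_sort y]
  congr 1
  funext i
  rw [(h2 i).1, (h2 i).2]

/-- List `M` in lexicographic order as `w`, and let `τ` be the stable sort of the swapped pairs.
This `τ` is the required involution. -/
theorem exists_pairMultiset_eq {m : ℕ} (M : Multiset (Fin (2 * m + 1) × Fin (2 * m + 1)))
    (hswap : M.map Prod.swap = M) (hM : ∀ p ∈ M, p.1 ≠ p.2 ∧ (p.1 : ℕ) % 2 = p.2 % 2)
    {N : ℕ} (hN : Multiset.card M = N) :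
    ∃ x : ColouredInvolution N m, pairMultiset x = M := by
  subst hN
  obtain ⟨w, hw, hwM⟩ : ∃ w : Fin (Multiset.card M) → Fin (2 * m + 1) × Fin (2 * m + 1),
      Monotone (fun i => toLex (w i)) ∧
        (univ : Finset (Fin (Multiset.card M))).val.map w = M := by
    obtain ⟨f, hf, hfM⟩ := exists_monotone_map_univ_eq (M.map toLex)
    have hc : Multiset.card (M.map toLex) = Multiset.card M := Multiset.card_map _ _
    revert f
    rw [hc]
    intro f hf hfM
    refine ⟨fun i => ofLex (f i), by simpa using hf, ?_⟩
    have := congrArg (Multiset.map ofLex) hfM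
    simpa [Multiset.map_map, Function.comp_def] using this
  set u : Fin (Multiset.card M) → Fin (2 * m + 1) ×ₗ Fin (2 * m + 1) :=
    fun i => toLex (w i).swap with hu
  set τ := Tuple.sort u with hτ
  obtain ⟨hτ1, hτ2⟩ := Tuple.eq_sort_iff.1 hτ
  -- Swap-invariance of `M`: the sorted list of swapped pairs is `w` again.
  have huτ : ∀ i, (w (τ i)).swap = w i := by
    have : u ∘ τ = fun i => toLex (w i) := by
      refine eq_of_monotone_of_map_univ_eq hτ1 hw ?_
      have e1 : (univ : Finset (Fin (Multiset.card M))).val.map (u ∘ τ) =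
          (univ : Finset (Fin (Multiset.card M))).val.map u := by
        conv_rhs => rw [← Finset.map_univ_equiv τ, Finset.map_val, Multiset.map_map]
        rfl
      have e2 : (univ : Finset (Fin (Multiset.card M))).val.map u =
          (((univ : Finset (Fin (Multiset.card M))).val.map w).map Prod.swap).map toLex := by
        rw [Multiset.map_map, Multiset.map_map]
        rfl
      have e3 : (univ : Finset (Fin (Multiset.card M))).val.map (fun i => toLex (w i)) =
          ((univ : Finset (Fin (Multiset.card M))).val.map w).map toLex := by
        rw [Multiset.map_map]
        rfl
      rw [e1, e2, e3, hwM, hswap]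
    intro i
    exact congrArg ofLex (congrFun this i)
  have hwτ : ∀ i, w (τ i) = (w i).swap := fun i => by rw [← huτ i, Prod.swap_swap]
  have hinc : ∀ i j, i < j → w i = w j → τ i < τ j := fun i j hij h =>
    hτ2 i j hij (by simp only [hu, huτ, h])
  have hai : ∀ i, τ (τ⁻¹ i) = i := τ.apply_symm_apply
  -- `τ⁻¹` also sorts the swapped pairs stably, and the stable sort is unique.
  have hinv : τ⁻¹ = τ := by
    rw [hτ, Tuple.eq_sort_iff, ← hτ]
    have h1 : ∀ i, w (τ⁻¹ i) = (w i).swap := fun i => by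
      have := huτ (τ⁻¹ i)
      rw [hai] at this
      exact this.symm
    have h2 : u ∘ ⇑τ⁻¹ = fun i => toLex (w i) := by
      funext i
      simp only [hu, Function.comp_apply, h1, Prod.swap_swap]
    refine ⟨by rw [h2]; exact hw, fun i j hij h => ?_⟩
    have h3 : w (τ⁻¹ i) = w (τ⁻¹ j) := Prod.swap_injective h
    by_contra hlt
    rcases (not_lt.1 hlt).lt_or_eq with h4 | h4
    · have := hinc _ _ h4 h3.symm
      rw [hai, hai] at this
      exact lt_asymm this hij
    · exact hij.ne (τ⁻¹.injective h4).symm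
  have hmem : ∀ i, w i ∈ M := fun i => by
    rw [← hwM]
    exact Multiset.mem_map_of_mem _ (mem_univ i)
  refine ⟨⟨(τ, fun i => (w i).1), ⟨fun i => ?_, fun i h => ?_⟩, fun i => ?_, fun i j hij => ?_,
    fun i j hij h => ?_⟩, ?_⟩
  · dsimp only
    conv_lhs => rw [← hinv]
    nth_rewrite 2 [hinv]
    simp
  · have h1 := hwτ i
    dsimp only at h
    rw [h] at h1
    exact (hM _ (hmem i)).1 (congrArg Prod.fst h1)
  · dsimp only
    rw [hwτ]
    exact (hM _ (hmem i)).2.symm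
  · rcases Prod.Lex.toLex_le_toLex.1 (hw hij) with h | h
    exacts [h.le, h.1.le]
  · dsimp only at h ⊢
    by_cases h2 : w i = w j
    · exact hinc i j hij h2
    · rcases Prod.Lex.toLex_le_toLex.1 (hw hij.le) with h3 | h3
      · exact absurd h h3.ne
      · by_contra h4
        rcases Prod.Lex.toLex_le_toLex.1 (hw (not_lt.1 h4)) with h5 | h5
        · rw [hwτ, hwτ] at h5
          exact absurd h3.2 (not_le.2 h5)
        · rw [hwτ, hwτ] at h5
          exact h2 (Prod.ext h h5.1.symm)
  · conv_rhs => rw [← hwM]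
    unfold pairMultiset
    refine Multiset.map_congr rfl fun i _ => ?_
    dsimp only
    rw [hwτ]
    rfl

/-- The swap-invariant multiset generated by a multiset of pairs `a < b`. -/
def symmetrize {m : ℕ} (S : Multiset (ColourPair m)) :
    Multiset (Fin (2 * m + 1) × Fin (2 * m + 1)) :=
  S.map Subtype.val + (S.map Subtype.val).map Prod.swap

theorem symmetrize_filter {m : ℕ} (S : Multiset (ColourPair m)) :
    (symmetrize S).filter (fun p => p.1 < p.2) = S.map Subtype.val := by
  unfold symmetrize
  rw [Multiset.filter_add, Multiset.filter_eq_self.2, Multiset.filter_eq_nil.2, add_zero]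
  · intro p hp
    simp only [Multiset.mem_map] at hp
    obtain ⟨_, ⟨q, -, rfl⟩, rfl⟩ := hp
    exact not_lt.2 q.2.1.le
  · intro p hp
    obtain ⟨q, -, rfl⟩ := Multiset.mem_map.1 hp
    exact q.2.1

theorem symmetrize_map_swap {m : ℕ} (S : Multiset (ColourPair m)) :
    (symmetrize S).map Prod.swap = symmetrize S := by
  unfold symmetrize
  generalize Multiset.map Subtype.val S = T
  rw [Multiset.map_add, add_comm (T.map _)]
  congr 1
  rw [Multiset.map_map, Prod.swap_swap_eq, Multiset.map_id]

theorem symmetrize_mem {m : ℕ} (S : Multiset (ColourPair m)) :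
    ∀ p ∈ symmetrize S, p.1 ≠ p.2 ∧ (p.1 : ℕ) % 2 = p.2 % 2 := by
  intro p hp
  rcases Multiset.mem_add.1 hp with hp | hp
  · obtain ⟨q, -, rfl⟩ := Multiset.mem_map.1 hp
    exact ⟨q.2.1.ne, q.2.2⟩
  · simp only [Multiset.mem_map] at hp
    obtain ⟨_, ⟨q, -, rfl⟩, rfl⟩ := hp
    exact ⟨q.2.1.ne', q.2.2.symm⟩

/-- Since `M` avoids the diagonal, it splits into the parts above and below it, which the swap
exchanges. -/
theorem exists_symmetrize_eq {m : ℕ} (M : Multiset (Fin (2 * m + 1) × Fin (2 * m + 1)))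
    (hswap : M.map Prod.swap = M) (hM : ∀ p ∈ M, p.1 ≠ p.2 ∧ (p.1 : ℕ) % 2 = p.2 % 2) :
    ∃ S : Multiset (ColourPair m), symmetrize S = M := by
  have h1 : ∀ p ∈ M.filter (fun p => p.1 < p.2), p.1 < p.2 ∧ (p.1 : ℕ) % 2 = p.2 % 2 :=
    fun p hp => ⟨(Multiset.mem_filter.1 hp).2, (hM p (Multiset.mem_filter.1 hp).1).2⟩
  refine ⟨(M.filter (fun p => p.1 < p.2)).pmap Subtype.mk h1, ?_⟩
  unfold symmetrize
  have h2 : ((M.filter (fun p => p.1 < p.2)).pmap Subtype.mk h1).map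
      (Subtype.val : ColourPair m → _) = M.filter (fun p => p.1 < p.2) := by
    rw [Multiset.map_pmap, Multiset.pmap_eq_map, Multiset.map_id']
  have h3 : (M.filter (fun p => p.1 < p.2)).map Prod.swap = M.filter (fun p => ¬ p.1 < p.2) := by
    conv_rhs => rw [← hswap]
    rw [Multiset.filter_map]
    congr 1
    refine Multiset.filter_congr fun p hp => ?_
    have := (hM p hp).1
    simp only [Function.comp, Prod.fst_swap, Prod.snd_swap, not_lt]
    exact ⟨le_of_lt, fun h => lt_of_le_of_ne h this⟩
  rw [h2, h3, Multiset.filter_add_not]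

theorem card_colouredInvolution (n m : ℕ) :
    Nat.card (ColouredInvolution (2 * n) m) = (m ^ 2 + n - 1).choose n := by
  have key : Nat.card (Sym (ColourPair m) n) = Nat.card (ColouredInvolution (2 * n) m) := by
    have hc : ∀ S : Sym (ColourPair m) n, Multiset.card (symmetrize S.1) = 2 * n := fun S => by
      simp [symmetrize, two_mul]
    choose f hf using fun S : Sym (ColourPair m) n =>
      exists_pairMultiset_eq _ (symmetrize_map_swap S.1) (symmetrize_mem S.1) (hc S)
    refine Nat.card_congr (Equiv.ofBijective f ⟨fun S T h => ?_, fun x => ?_⟩)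
    · have h1 : symmetrize S.1 = symmetrize T.1 := by rw [← hf, ← hf, h]
      have h2 := congrArg (Multiset.filter (fun p => p.1 < p.2)) h1
      rw [symmetrize_filter, symmetrize_filter] at h2
      exact Subtype.ext (Multiset.map_injective Subtype.val_injective h2)
    · obtain ⟨S, hS⟩ := exists_symmetrize_eq _ (pairMultiset_map_swap x) (pairMultiset_mem x)
      have hcS : Multiset.card S = n := by
        have h1 := congrArg Multiset.card hS
        simp only [symmetrize, pairMultiset, Multiset.card_add, Multiset.card_map, Finset.card_val,
          Finset.card_univ, Fintype.card_fin] at h1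
        omega
      exact ⟨⟨S, hcS⟩, pairMultiset_injective _ _ ((hf _).trans hS)⟩
  rw [← key, Nat.card_eq_fintype_card, Sym.card_sym_eq_choose, card_colourPair]

/-! ### Fixed-point free signed involutions as signed matchings. -/

/-- A fixed-point free involution `σ` of `Fin N` with signs constant on its cycles. -/
abbrev SignedMatching (N : ℕ) : Type :=
  {p : Equiv.Perm (Fin N) × (Fin N → Bool) //
    ((∀ i, p.1 (p.1 i) = i) ∧ (∀ i, p.1 i ≠ i)) ∧ ∀ i, p.2 (p.1 i) = p.2 i}

namespace SignedMatching

variable {N : ℕ}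

/-- The absolute values of the letters. -/
def absWord (x : SignedMatching N) : Fin (N + 1) → ℕ := Fin.cons 0 fun i => (x.1.1 i : ℕ) + 1

/-- The signs of the letters. -/
def signWord (x : SignedMatching N) : Fin (N + 1) → Bool := Fin.cons false x.1.2

/-- The letters. -/
def word (x : SignedMatching N) (j : Fin (N + 1)) : ℤ :=
  if x.signWord j then -(x.absWord j : ℤ) else x.absWord j

/-- The descents of the word of `x`. -/
def descents (x : SignedMatching N) : Finset (Fin N) :=
  univ.filter fun i => rLT (x.word i.succ) (x.word i.castSucc)

theorem absWord_zero (x : SignedMatching N) : x.absWord 0 = 0 := rfl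

theorem absWord_succ (x : SignedMatching N) (i : Fin N) : x.absWord i.succ = x.1.1 i + 1 := rfl

theorem signWord_zero (x : SignedMatching N) : x.signWord 0 = false := rfl

theorem signWord_succ (x : SignedMatching N) (i : Fin N) : x.signWord i.succ = x.1.2 i := rfl

theorem word_succ (x : SignedMatching N) (i : Fin N) :
    x.word i.succ = if x.1.2 i then -((x.1.1 i : ℤ) + 1) else (x.1.1 i : ℤ) + 1 := by
  simp [word, absWord_succ, signWord_succ]

theorem word_injective : Function.Injective (word : SignedMatching N → _) := by
  intro x y h
  have h1 : ∀ i, x.1.1 i = y.1.1 i ∧ x.1.2 i = y.1.2 i := fun i => by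
    have := congrFun h i.succ
    rw [word_succ, word_succ] at this
    rcases hx : x.1.2 i <;> rcases hy : y.1.2 i <;> simp only [hx, hy, if_true, if_false,
      Bool.false_eq_true, Fin.ext_iff, and_true, and_false, reduceCtorEq] at this ⊢ <;> omega
  exact Subtype.ext (Prod.ext (Equiv.ext fun i => (h1 i).1) (funext fun i => (h1 i).2))

theorem absWord_injective (x : SignedMatching N) : Function.Injective x.absWord := by
  refine Fin.cons_injective_iff.2 ⟨?_, ?_⟩
  · rintro ⟨i, hi⟩
    exact Nat.succ_ne_zero _ hi
  · intro i j h
    exact x.1.1.injective (Fin.ext (Nat.succ_injective h))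

/-- The value at the positive integer `a` of the signed permutation with word `x`, and `0`
elsewhere. -/
def posPart (x : SignedMatching N) (a : ℤ) : ℤ :=
  if h : 1 ≤ a ∧ a ≤ N then x.word (Fin.succ ⟨(a - 1).toNat, by omega⟩) else 0

/-- The signed permutation with word `x`, extended by zero to `ℤ`. -/
def extend (x : SignedMatching N) (a : ℤ) : ℤ := x.posPart a - x.posPart (-a)

theorem extend_neg (x : SignedMatching N) (a : ℤ) : x.extend (-a) = -x.extend a := by
  simp [extend]

theorem posPart_succ (x : SignedMatching N) (i : Fin N) :
    x.posPart ((i : ℤ) + 1) = x.word i.succ := by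
  have h : (1 : ℤ) ≤ (i : ℤ) + 1 ∧ ((i : ℤ) + 1) ≤ N := by omega
  rw [posPart, dif_pos h]
  congr 2
  simp

theorem posPart_nonpos (x : SignedMatching N) {a : ℤ} (ha : a ≤ 0) : x.posPart a = 0 :=
  dif_neg (by omega)

theorem extend_succ (x : SignedMatching N) (i : Fin N) :
    x.extend ((i : ℤ) + 1) = x.word i.succ := by
  rw [extend, posPart_succ, posPart_nonpos x (by omega), sub_zero]

theorem extend_zero (x : SignedMatching N) : x.extend 0 = 0 := by simp [extend]

theorem omega_cases (a : Omega N) :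
    a.1 = 0 ∨ ∃ i : Fin N, a.1 = (i : ℤ) + 1 ∨ a.1 = -((i : ℤ) + 1) := by
  have h := a.2
  rcases lt_trichotomy a.1 0 with h1 | h1 | h1
  · exact Or.inr ⟨⟨(-a.1 - 1).toNat, by omega⟩, Or.inr (by simp only; omega)⟩
  · exact Or.inl h1
  · exact Or.inr ⟨⟨(a.1 - 1).toNat, by omega⟩, Or.inl (by simp only; omega)⟩

theorem word_bound (x : SignedMatching N) (i : Fin N) :
    -(N : ℤ) ≤ x.word i.succ ∧ x.word i.succ ≤ N := by
  rw [word_succ]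
  have := (x.1.1 i).2
  split_ifs <;> omega

theorem extend_bound (x : SignedMatching N) (a : Omega N) :
    -(N : ℤ) ≤ x.extend a.1 ∧ x.extend a.1 ≤ N := by
  rcases omega_cases a with h | ⟨i, h | h⟩
  · rw [h, extend_zero]; omega
  · rw [h, extend_succ]; exact x.word_bound i
  · rw [h, extend_neg, extend_succ]; have := x.word_bound i; omega

theorem extend_word_succ (x : SignedMatching N) (i : Fin N) :
    x.extend (x.word i.succ) = (i : ℤ) + 1 := by
  rw [word_succ]
  split_ifs with h
  · rw [extend_neg, extend_succ, word_succ, x.2.2, if_pos h, x.2.1.1]; ring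
  · rw [extend_succ, word_succ, x.2.2, if_neg h, x.2.1.1]

theorem extend_extend (x : SignedMatching N) (a : Omega N) : x.extend (x.extend a.1) = a.1 := by
  rcases omega_cases a with h | ⟨i, h | h⟩
  · rw [h, extend_zero, extend_zero]
  · rw [h, extend_succ, extend_word_succ]
  · rw [h, extend_neg, extend_neg, extend_succ, extend_word_succ]

/-- The signed permutation with word `x`. -/
def toSigned (x : SignedMatching N) : hyperoctahedral N :=
  ⟨Function.Involutive.toPerm (fun a => ⟨x.extend a.1, x.extend_bound a⟩)
    fun a => Subtype.ext (x.extend_extend a), fun a => Subtype.ext (x.extend_neg a.1)⟩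

theorem letter_toSigned (x : SignedMatching N) : letter x.toSigned = x.word := by
  funext j
  induction j using Fin.cases with
  | zero => exact x.extend_zero
  | succ i =>
    rw [← extend_succ]
    change x.extend ((i.succ : ℕ) : ℤ) = _
    simp

theorem toSigned_fixedPointFree (x : SignedMatching N) :
    IsFixedPointFreeInvolution x.toSigned := by
  refine ⟨Subtype.ext (Equiv.ext fun _ => rfl), fun j hj => ?_⟩
  rw [letter_toSigned]
  induction j using Fin.cases with
  | zero => simp at hj
  | succ i =>
    have h := x.2.1.2 i
    rw [Ne, Fin.ext_iff] at h
    rw [word_succ, Fin.val_succ]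
    split_ifs <;> push_cast <;> omega

end SignedMatching

theorem letter_injective {N : ℕ} : Function.Injective (letter : hyperoctahedral N → _) := by
  intro π ρ h
  have h1 : ∀ j, π.1 (Omega.ofIndex j) = ρ.1 (Omega.ofIndex j) := fun j =>
    Subtype.ext (congrFun h j)
  refine Subtype.ext (Equiv.ext fun a => ?_)
  by_cases ha : 0 ≤ a.1
  · have : a = Omega.ofIndex ⟨a.1.toNat, by have := a.2; omega⟩ :=
      Subtype.ext (by simp only [Omega.ofIndex]; omega)
    rw [this, h1]
  · have : a = (Omega.ofIndex ⟨(-a.1).toNat, by have := a.2; omega⟩ : Omega N).opp :=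
      Subtype.ext (by simp only [Omega.ofIndex, Omega.opp]; omega)
    rw [this, π.2, ρ.2, h1]

theorem letter_zero {N : ℕ} (π : hyperoctahedral N) : letter π 0 = 0 := by
  have h0 : (Omega.ofIndex 0 : Omega N).opp = Omega.ofIndex 0 :=
    Subtype.ext (by simp [Omega.ofIndex, Omega.opp])
  have h := congrArg Subtype.val (π.2 (Omega.ofIndex 0))
  rw [h0] at h
  change letter π 0 = -letter π 0 at h
  omega

/-- The value of an involution at a letter. -/
theorem letter_natAbs_letter {N : ℕ} {π : hyperoctahedral N} (hπ : π⁻¹ = π) (i j : Fin (N + 1))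
    (hj : (j : ℕ) = (letter π i).natAbs) :
    letter π j = if letter π i < 0 then -(i : ℤ) else i := by
  have hinv : ∀ a, π.1 (π.1 a) = a := fun a => by
    have h : π.1⁻¹ = π.1 := congrArg Subtype.val hπ
    nth_rewrite 1 [← h]
    exact π.1.symm_apply_apply a
  split_ifs with h
  · have h1 : (Omega.ofIndex j : Omega N) = (π.1 (Omega.ofIndex i)).opp := by
      refine Subtype.ext ?_
      change ((j : ℕ) : ℤ) = -letter π i
      omega
    unfold letter
    rw [h1, π.2, hinv]
    rfl
  · have h1 : (Omega.ofIndex j : Omega N) = π.1 (Omega.ofIndex i) := by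
      refine Subtype.ext ?_
      change ((j : ℕ) : ℤ) = letter π i
      omega
    unfold letter
    rw [h1, hinv]
    rfl

/-- The matching is `i ↦ |π i|`, shifted by one to index from zero. If `π i = ±j` then `π j = ±i`
with the same sign, so signs are constant on cycles. -/
theorem exists_toSigned_eq {N : ℕ} (π : hyperoctahedral N) (hπ : IsFixedPointFreeInvolution π) :
    ∃ x : SignedMatching N, x.toSigned = π := by
  obtain ⟨hinv, hfix⟩ := hπ
  have hb : ∀ j, (letter π j).natAbs ≤ N := fun j => by
    have := (π.1 (Omega.ofIndex j)).2
    change -(N : ℤ) ≤ letter π j ∧ letter π j ≤ N at this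
    omega
  have hne : ∀ i : Fin N, letter π i.succ ≠ 0 := fun i h => by
    have := letter_natAbs_letter hinv i.succ 0 (by rw [h]; rfl)
    rw [letter_zero, h] at this
    simp at this
    omega
  have hlt : ∀ i : Fin N, (letter π i.succ).natAbs - 1 < N := fun i => by
    have := hne i; have := hb i.succ; omega
  have hmate : ∀ i : Fin N, letter π (Fin.succ ⟨_, hlt i⟩) =
      if letter π i.succ < 0 then -((i.succ : ℕ) : ℤ) else ((i.succ : ℕ) : ℤ) := fun i =>
    letter_natAbs_letter hinv i.succ _ (by have := hne i; rw [Fin.val_succ]; simp only; omega)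
  have hsig : Function.Involutive (fun i : Fin N => (⟨_, hlt i⟩ : Fin N)) := fun i => by
    apply Fin.ext
    simp only
    rw [hmate i, Fin.val_succ]
    split_ifs <;> omega
  refine ⟨⟨(hsig.toPerm, fun i => decide (letter π i.succ < 0)), ⟨hsig, fun i h => ?_⟩,
    fun i => ?_⟩, letter_injective ?_⟩
  · have h1 := hfix i.succ (by simp)
    have h2 := congrArg Fin.val h
    change (letter π i.succ).natAbs - 1 = i at h2
    rw [Fin.val_succ] at h1
    have := hne i
    omega
  · simp only [decide_eq_decide]
    change letter π (Fin.succ ⟨_, hlt i⟩) < 0 ↔ _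
    rw [hmate i, Fin.val_succ]
    split_ifs <;> omega
  · rw [SignedMatching.letter_toSigned]
    funext j
    induction j using Fin.cases with
    | zero => rw [letter_zero]; rfl
    | succ i =>
      rw [SignedMatching.word_succ]
      have := hne i
      change (if decide (letter π i.succ < 0) = true then
        -((((letter π i.succ).natAbs - 1 : ℕ) : ℤ) + 1)
        else (((letter π i.succ).natAbs - 1 : ℕ) : ℤ) + 1) = _
      simp only [decide_eq_true_eq]
      split_ifs <;> omega

theorem J_eq_card (N : ℕ) (k : ℤ) :
    J N k = (univ.filter fun x : SignedMatching N => (x.descents.card : ℤ) = k).card := by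
  rw [← Set.ncard_coe_finset]
  refine (Set.ncard_congr (fun x _ => x.toSigned) ?_ ?_ ?_).symm
  · intro x hx
    refine ⟨x.toSigned_fixedPointFree, ?_⟩
    have hx : (x.descents.card : ℤ) = k := by simpa using hx
    rw [← hx, rDes, rDescents, SignedMatching.letter_toSigned]
    rfl
  · intro x y _ _ h
    apply SignedMatching.word_injective
    rw [← SignedMatching.letter_toSigned, ← SignedMatching.letter_toSigned, h]
  · rintro π ⟨hπ, hk⟩
    obtain ⟨x, rfl⟩ := exists_toSigned_eq π hπ
    refine ⟨x, ?_, rfl⟩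
    rw [rDes, rDescents, SignedMatching.letter_toSigned] at hk
    simp only [coe_filter, mem_univ, true_and, Set.mem_ofPred_eq]
    exact hk

/-! ### From chains to colourings. -/

/-- Comparing neighbouring positions of a word: the condition imposed on a chain is the
lexicographic order on pairs (colour, absolute value). -/
theorem chain_step_iff {F F' a a' : ℕ} {s s' : Bool} (hs : s = true → a ≠ 0)
    (ha' : a' ≠ 0) (hne : a ≠ a') :
    (F + (if rLT (if s' then -(a' : ℤ) else a') (if s then -(a : ℤ) else a) then 1 else 0) ≤ F') ↔
      toLex (2 * (F : ℤ) - s.toNat, a) < toLex (2 * (F' : ℤ) - s'.toNat, a') := by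
  rw [Prod.Lex.toLex_lt_toLex]
  unfold rLT
  cases s <;> cases s' <;> simp at hs ⊢ <;> split_ifs <;> omega

/-- Where `F` is constant the letters must increase in the `r`-order: negative ones first (colour
`2F - 1`), then nonnegative ones (colour `2F`), each group by absolute value. This local condition
globalises because a lexicographic order is transitive. -/
theorem chain_iff_strictMono {N m : ℕ} (x : SignedMatching N) (F : Fin (N + 1) → Fin (m + 1)) :
    (∀ i : Fin N, (F i.castSucc : ℕ) + (if i ∈ x.descents then 1 else 0) ≤ F i.succ) ↔
      StrictMono fun j => toLex (2 * ((F j : ℕ) : ℤ) - (x.signWord j).toNat, x.absWord j) := by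
  rw [Fin.strictMono_iff_lt_succ]
  refine forall_congr' fun i => ?_
  rw [← chain_step_iff]
  · simp only [SignedMatching.descents, mem_filter, mem_univ, true_and]
    rfl
  · intro hs h
    have h0 : i.castSucc = 0 := x.absWord_injective h
    rw [h0] at hs
    exact Bool.false_ne_true hs
  · rw [SignedMatching.absWord_succ]; omega
  · exact fun h => (Fin.castSucc_lt_succ (i := i)).ne (x.absWord_injective h)

/-- The signed matching underlying a coloured involution: odd colours are negative. -/
def ColouredInvolution.toMatching {N m : ℕ} (x : ColouredInvolution N m) : SignedMatching N :=
  ⟨(x.1.1, fun i => decide ((x.1.2 i : ℕ) % 2 = 1)), x.2.1, fun i => by simp only [x.2.2.1]⟩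

/-- The chain of halved colours. -/
def ColouredInvolution.toChain {N m : ℕ} (x : ColouredInvolution N m) :
    StrictChain x.toMatching.descents m :=
  ⟨Fin.cons 0 fun i => ⟨((x.1.2 i : ℕ) + 1) / 2, by have := (x.1.2 i).2; omega⟩, rfl, by
    rw [chain_iff_strictMono]
    have h2 : ∀ i : Fin N, 2 * ((((x.1.2 i : ℕ) + 1) / 2 : ℕ) : ℤ) -
        (decide ((x.1.2 i : ℕ) % 2 = 1)).toNat = (x.1.2 i : ℕ) := fun i => by
      rcases Nat.mod_two_eq_zero_or_one (x.1.2 i : ℕ) with h | h <;> simp [h] <;> omega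
    intro j k hjk
    induction k using Fin.cases with
    | zero => exact absurd hjk (Fin.not_lt_zero j)
    | succ k =>
      simp only [Fin.cons_succ, SignedMatching.signWord_succ, SignedMatching.absWord_succ]
      rw [ColouredInvolution.toMatching, h2, Prod.Lex.toLex_lt_toLex]
      induction j using Fin.cases with
      | zero =>
        simp only [Fin.cons_zero, SignedMatching.signWord_zero, SignedMatching.absWord_zero,
          Fin.val_zero, Bool.toNat_false, Nat.cast_zero]
        omega
      | succ j =>
        simp only [Fin.cons_succ, SignedMatching.signWord_succ, SignedMatching.absWord_succ]
        rw [h2]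
        have hjk := Fin.succ_lt_succ_iff.1 hjk
        have h3 := x.2.2.2.1 hjk.le
        have h4 := x.2.2.2.2 j k hjk
        simp only [Fin.le_def, Fin.lt_def, Fin.ext_iff] at h3 h4 ⊢
        omega⟩

theorem card_chains (N m : ℕ) :
    ∑ x : SignedMatching N, Nat.card (StrictChain x.descents m) =
      Nat.card (ColouredInvolution N m) := by
  rw [← Nat.card_sigma]
  refine (Nat.card_congr (Equiv.ofBijective
    (fun x : ColouredInvolution N m => (⟨x.toMatching, x.toChain⟩ :
      Σ x : SignedMatching N, StrictChain x.descents m)) ⟨?_, ?_⟩)).symm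
  · intro x y h
    have h1 : x.toMatching = y.toMatching := congrArg Sigma.fst h
    have h2 : x.toChain.1 = y.toChain.1 := by
      dsimp only at h
      generalize x.toChain = F, y.toChain = G at h ⊢
      revert F G
      rw [h1]
      intro F G h
      rw [eq_of_heq (Sigma.mk.inj h).2]
    refine Subtype.ext (Prod.ext (congrArg (fun z => z.1.1) h1) (funext fun i => Fin.ext ?_))
    have h3 : decide ((x.1.2 i : ℕ) % 2 = 1) = decide ((y.1.2 i : ℕ) % 2 = 1) :=
      congrFun (congrArg (fun z => z.1.2) h1) i
    have h4 : ((x.1.2 i : ℕ) + 1) / 2 = ((y.1.2 i : ℕ) + 1) / 2 :=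
      congrArg Fin.val (congrFun h2 i.succ)
    rw [decide_eq_decide] at h3
    omega
  · rintro ⟨⟨⟨σ, s⟩, hσ, hs⟩, F, hF0, hF⟩
    have hmono := (chain_iff_strictMono _ F).1 hF
    have hlex : ∀ i j : Fin N, i < j →
        2 * ((F i.succ : ℕ) : ℤ) - (s i).toNat < 2 * ((F j.succ : ℕ) : ℤ) - (s j).toNat ∨
          2 * ((F i.succ : ℕ) : ℤ) - (s i).toNat = 2 * ((F j.succ : ℕ) : ℤ) - (s j).toNat ∧
            σ i < σ j := fun i j hij => by
      have := hmono (Fin.succ_lt_succ_iff.2 hij)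
      rw [Prod.Lex.toLex_lt_toLex] at this
      simpa [SignedMatching.signWord_succ, SignedMatching.absWord_succ] using this
    -- Comparison with position `0`, of colour `0`, shows that colours are nonnegative, so the
    -- natural subtraction below is exact.
    have hpos : ∀ i : Fin N, (s i).toNat ≤ 2 * (F i.succ : ℕ) := fun i => by
      have := hmono (Fin.succ_pos i)
      rw [Prod.Lex.toLex_lt_toLex] at this
      simp only [SignedMatching.signWord_zero, SignedMatching.signWord_succ, hF0,
        Bool.toNat_false] at this
      omega
    have hle : ∀ i : Fin N, (s i).toNat ≤ 1 := fun i => Bool.toNat_le _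
    refine ⟨⟨(σ, fun i => ⟨2 * (F i.succ : ℕ) - (s i).toNat, by
      have := (F i.succ).2; omega⟩), hσ, fun i => ?_, fun i j hij => ?_, fun i j hij h => ?_⟩, ?_⟩
    · have h1 := hpos i
      have h2 := hpos (σ i)
      have h3 := hle i
      have h4 := hs i
      simp only at h4 ⊢
      rw [h4] at h2 ⊢
      omega
    · rcases hij.lt_or_eq with hij | rfl
      · have h1 := hpos i
        have h2 := hpos j
        have h3 := hlex i j hij
        simp only [Fin.le_def]
        omega
      · exact le_rfl
    · have h1 := hpos i
      have h2 := hpos j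
      have h3 := hlex i j hij
      simp only [Fin.mk.injEq] at h
      rcases h3 with h3 | h3
      · omega
      · exact h3.2
    · have e1 : ∀ i, decide ((2 * (F i.succ : ℕ) - (s i).toNat) % 2 = 1) = s i := fun i => by
        have h1 := hpos i
        cases h : s i
        · simp
        · simp only [h, Bool.toNat_true, decide_eq_true_eq] at h1 ⊢
          omega
      have e2 : ∀ i, ((2 * (F i.succ : ℕ) - (s i).toNat) + 1) / 2 = (F i.succ : ℕ) := fun i => by
        have h1 := hpos i
        have h2 := hle i
        omega
      have key : ∀ (z w : Σ x : SignedMatching N, StrictChain x.descents m),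
          z.1 = w.1 → z.2.1 = w.2.1 → z = w := by
        rintro ⟨x, F⟩ ⟨y, G⟩ h1 h2
        obtain rfl : x = y := h1
        obtain rfl : F = G := Subtype.ext h2
        rfl
      refine key _ _ (Subtype.ext (Prod.ext rfl (funext e1))) (funext fun j => Fin.ext ?_)
      induction j using Fin.cases with
      | zero => exact hF0.symm
      | succ i => exact e2 i

/-! ### The counting identity and the recurrence. -/

theorem sum_J_mul_choose {n : ℕ} (hn : 1 ≤ n) (m : ℕ) :
    ∑ k ∈ range (m + 1), J (2 * n) k * (m + 1 - k + 2 * n - 1).choose (2 * n) =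
      (m ^ 2 + n - 1).choose n := by
  rw [← card_colouredInvolution, ← card_chains]
  simp only [card_strictChain, J_eq_card, card_filter, sum_mul]
  rw [sum_comm]
  refine sum_congr rfl fun x _ => ?_
  simp only [Nat.cast_inj, ite_mul, one_mul, zero_mul, sum_ite_eq, mem_range]
  split_ifs with h
  · rfl
  -- With more than `m` descents the truncated binomial is `C(2n - 1, 2n) = 0`.
  · rw [Nat.choose_eq_zero_of_lt]
    omega

/-- The coefficients are those of the recurrence at `k`, `k + 1`, `k + 2`. With `j = m - k`, every
binomial times `(N + 1)(N + 2)` is a polynomial multiple of `C(j + N, N)`, which leaves a polynomial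
identity. -/
theorem choose_three_term (n : ℕ) {N : ℕ} (hN : N + 2 = 2 * n) {m k : ℕ} (hk : k ≤ m) :
    ((m : ℤ) ^ 2 + n - 1) * (m + 1 - k + N - 1).choose N =
      ((k : ℤ) ^ 2 + n - 1) * (m + 1 - k + 2 * n - 1).choose (2 * n) +
      (2 * (k : ℤ) * (2 * n - (k + 1)) + 1) * (m + 1 - (k + 1) + 2 * n - 1).choose (2 * n) +
      ((k : ℤ) * (k + 2 - 4 * n) + 4 * (n : ℤ) ^ 2 - 3 * n) *
        (m + 1 - (k + 2) + 2 * n - 1).choose (2 * n) := by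
  obtain ⟨j, rfl⟩ := Nat.exists_eq_add_of_le hk
  rw [← hN]
  have e0 : k + j + 1 - k + N - 1 = j + N := by omega
  have e1 : k + j + 1 - k + (N + 2) - 1 = j + N + 2 := by omega
  have e2 : k + j + 1 - (k + 1) + (N + 2) - 1 = j + N + 1 := by omega
  -- For `j = 0` the subtraction truncates and the upper indices differ, but both binomials vanish.
  have e3 : (k + j + 1 - (k + 2) + (N + 2) - 1).choose (N + 2) = (j + N).choose (N + 2) := by
    rcases Nat.eq_zero_or_pos j with rfl | hj
    · rw [Nat.choose_eq_zero_of_lt (by omega), Nat.choose_eq_zero_of_lt (by omega)]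
    · congr 1; omega
  rw [e0, e1, e2, e3]
  have a1 := Nat.add_one_mul_choose_eq (j + N) N
  have a2 := Nat.add_one_mul_choose_eq (j + N + 1) (N + 1)
  have b1 := Nat.choose_succ_right_eq (j + N) N
  have b2 := Nat.add_one_mul_choose_eq (j + N) (N + 1)
  have c2 : ((j + N).choose (N + 2) : ℤ) * (N + 2) = (j + N).choose (N + 1) * (j - 1) := by
    have h := Nat.choose_succ_right_eq (j + N) (N + 1)
    rcases Nat.eq_zero_or_pos j with rfl | hj
    · rw [Nat.choose_eq_zero_of_lt (by omega), Nat.choose_eq_zero_of_lt (by omega)]; simp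
    · rw [show j + N - (N + 1) = j - 1 by omega] at h
      zify [hj] at h
      linear_combination h
  rw [Nat.add_sub_cancel] at b1
  zify at a1 a2 b1 b2
  have hpos : ((N : ℤ) + 1) * (N + 2) ≠ 0 := by positivity
  apply mul_left_cancel₀ hpos
  generalize ((j + N).choose N : ℤ) = X at *
  generalize ((j + N + 1).choose (N + 1) : ℤ) = Y1 at *
  generalize ((j + N + 2).choose (N + 2) : ℤ) = Z1 at *
  generalize ((j + N).choose (N + 1) : ℤ) = Y2 at *
  generalize ((j + N + 1).choose (N + 2) : ℤ) = Z2 at *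
  generalize ((j + N).choose (N + 2) : ℤ) = Z3 at *
  have f1 : Z1 * ((N + 2) * (N + 1)) = (j + N + 2) * (j + N + 1) * X := by
    linear_combination (-(N : ℤ) - 1) * a2 - (j + N + 2) * a1
  have f2 : Z2 * ((N + 2) * (N + 1)) = (j + N + 1) * j * X := by
    linear_combination (-(N : ℤ) - 1) * b2 + (j + N + 1) * b1
  have f3 : Z3 * ((N + 2) * (N + 1)) = j * (j - 1) * X := by
    linear_combination ((N : ℤ) + 1) * c2 + (j - 1) * b1
  have hN' : (N : ℤ) = 2 * n - 2 := by omega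
  push_cast
  rw [hN'] at f1 f2 f3 ⊢
  linear_combination (-((k : ℤ) ^ 2 + n - 1)) * f1 -
    (2 * (k : ℤ) * (2 * n - (k + 1)) + 1) * f2 -
    ((k : ℤ) * (k + 2 - 4 * n) + 4 * (n : ℤ) ^ 2 - 3 * n) * f3

theorem sum_shift (φ : ℤ → ℤ) (ψ : ℕ → ℤ) {m : ℕ} (hφ : φ (-1) = 0) (hψ : ψ (m + 1) = 0) :
    ∑ k ∈ range (m + 1), φ ((k : ℤ) - 1) * ψ k = ∑ k ∈ range (m + 1), φ k * ψ (k + 1) := by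
  rw [sum_range_succ', sum_range_succ]
  simp [hφ, hψ]

/-- A triangular system with unit diagonal has at most one solution. -/
theorem eq_of_triangular_sum_eq {u v : ℕ → ℤ} {G : ℕ → ℕ → ℤ} (hG : ∀ m, G m m = 1)
    (h : ∀ m, ∑ k ∈ range (m + 1), u k * G m k = ∑ k ∈ range (m + 1), v k * G m k) (m : ℕ) :
    u m = v m := by
  induction m using Nat.strong_induction_on with
  | _ m ih =>
    have hm := h m
    rw [sum_range_succ, sum_range_succ, hG, sum_congr rfl fun k hk => by
      rw [ih k (mem_range.1 hk)]] at hm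
    linarith

theorem J_neg (N : ℕ) {k : ℤ} (hk : k < 0) : J N k = 0 := by
  rw [J_eq_card, card_eq_zero, filter_eq_empty_iff]
  intro x _
  omega

theorem J_recurrence (n k : ℕ) (hn : 2 ≤ n) :
    (n : ℤ) * (J (2 * n) k : ℤ) =
      ((k : ℤ) ^ 2 + n - 1) * (J (2 * n - 2) k : ℤ) +
      (2 * ((k : ℤ) - 1) * (2 * n - k) + 1) * (J (2 * n - 2) ((k : ℤ) - 1) : ℤ) +
      (((k : ℤ) - 2) * (k - 4 * n) + 4 * (n : ℤ) ^ 2 - 3 * n) *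
        (J (2 * n - 2) ((k : ℤ) - 2) : ℤ) := by
  set v : ℤ → ℤ := fun k => (J (2 * n - 2) k : ℤ) with hv
  have hneg : ∀ k : ℤ, k < 0 → v k = 0 := fun k hk => by simp [hv, J_neg _ hk]
  set G : ℕ → ℕ → ℤ := fun m k => ((m + 1 - k + 2 * n - 1).choose (2 * n) : ℤ) with hGdef
  have hG0 : ∀ m k, m < k → G m k = 0 := fun m k h => by
    simp only [hGdef]
    rw [Nat.choose_eq_zero_of_lt (by omega), Nat.cast_zero]
  refine eq_of_triangular_sum_eq (u := fun k => (n : ℤ) * (J (2 * n) k : ℤ))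
    (v := fun k => ((k : ℤ) ^ 2 + n - 1) * v k +
      (2 * ((k : ℤ) - 1) * (2 * n - k) + 1) * v ((k : ℤ) - 1) +
      (((k : ℤ) - 2) * (k - 4 * n) + 4 * (n : ℤ) ^ 2 - 3 * n) * v ((k : ℤ) - 2))
    (G := G) (fun m => ?_) (fun m => ?_) k
  · simp only [hGdef]
    rw [show m + 1 - m + 2 * n - 1 = 2 * n by omega, Nat.choose_self, Nat.cast_one]
  · have h1 : ∑ k ∈ range (m + 1), (n : ℤ) * (J (2 * n) k : ℤ) * G m k =
        n * ((m ^ 2 + n - 1).choose n : ℤ) := by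
      rw [← sum_J_mul_choose (by omega) m]
      push_cast
      rw [mul_sum]
      exact sum_congr rfl fun k _ => mul_assoc _ _ _
    have h2 : ∑ k ∈ range (m + 1), v k * ((m + 1 - k + (2 * n - 2) - 1).choose (2 * n - 2) : ℤ) =
        ((m ^ 2 + (n - 1) - 1).choose (n - 1) : ℤ) := by
      rw [← sum_J_mul_choose (by omega) m, show 2 * (n - 1) = 2 * n - 2 by omega]
      push_cast
      rfl
    have h3 : (n : ℤ) * ((m ^ 2 + n - 1).choose n : ℤ) =
        ((m : ℤ) ^ 2 + n - 1) * ((m ^ 2 + (n - 1) - 1).choose (n - 1) : ℤ) := by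
      obtain ⟨p, rfl⟩ := Nat.exists_eq_add_of_le hn
      have h := Nat.add_one_mul_choose_eq (m ^ 2 + p) (p + 1)
      rw [show m ^ 2 + (2 + p) - 1 = m ^ 2 + p + 1 by omega,
        show m ^ 2 + (2 + p - 1) - 1 = m ^ 2 + p by omega, show 2 + p = p + 1 + 1 by omega,
        Nat.add_sub_cancel]
      zify at h
      push_cast
      linear_combination -h
    have s1 := sum_shift v
      (fun k => (2 * ((k : ℤ) - 1) * (2 * n - k) + 1) * G m k) (m := m)
      -- Both boundary terms vanish: `v` at negative indices, and `G m k` for `k > m`.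
      (hneg _ (by norm_num)) (by simp [hG0])
    -- The term in `k - 2` needs two successive shifts, `s2` and then `s3`.
    have s2 := sum_shift (fun k => v (k - 1))
      (fun k => (((k : ℤ) - 2) * (k - 4 * n) + 4 * (n : ℤ) ^ 2 - 3 * n) * G m k) (m := m)
      (hneg _ (by norm_num)) (by simp [hG0])
    have s3 := sum_shift v
      (fun k => ((((k + 1 : ℕ) : ℤ) - 2) * (((k + 1 : ℕ) : ℤ) - 4 * n) +
        4 * (n : ℤ) ^ 2 - 3 * n) * G m (k + 1)) (m := m)
      (hneg _ (by norm_num)) (by simp [hG0])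
    rw [h1, h3, ← h2, mul_sum]
    have h4 : ∀ k : ℕ, (((k : ℤ) ^ 2 + n - 1) * v k +
        (2 * ((k : ℤ) - 1) * (2 * n - k) + 1) * v ((k : ℤ) - 1) +
        (((k : ℤ) - 2) * (k - 4 * n) + 4 * (n : ℤ) ^ 2 - 3 * n) * v ((k : ℤ) - 2)) * G m k =
        v k * (((k : ℤ) ^ 2 + n - 1) * G m k) +
        v ((k : ℤ) - 1) * ((2 * ((k : ℤ) - 1) * (2 * n - k) + 1) * G m k) +
        v ((k : ℤ) - 1 - 1) * ((((k : ℤ) - 2) * (k - 4 * n) + 4 * (n : ℤ) ^ 2 - 3 * n) * G m k) :=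
      fun k => by rw [show (k : ℤ) - 1 - 1 = k - 2 by ring]; ring
    simp only [h4, sum_add_distrib]
    rw [s1, s2, s3, ← sum_add_distrib, ← sum_add_distrib]
    refine sum_congr rfl fun k hk => ?_
    have h5 : ((m : ℤ) ^ 2 + n - 1) * (m + 1 - k + (2 * n - 2) - 1).choose (2 * n - 2) =
        ((k : ℤ) ^ 2 + n - 1) * G m k + (2 * (k : ℤ) * (2 * n - (k + 1)) + 1) * G m (k + 1) +
        ((k : ℤ) * (k + 2 - 4 * n) + 4 * (n : ℤ) ^ 2 - 3 * n) * G m (k + 2) :=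
      choose_three_term n (by omega) (Nat.lt_succ_iff.1 (mem_range.1 hk))
    have h6 : k + 1 + 1 = k + 2 := rfl
    simp only [h6]
    push_cast
    linear_combination v k * h5

end SignedInvolution

theorem mainTheorem7 :
    (∀ (n : ℕ) (k : ℤ), 2 ≤ n → 0 ≤ k →
      (n : ℤ) * (SignedInvolution.J (2 * n) k : ℤ) =
        (k ^ 2 + (n : ℤ) - 1) * (SignedInvolution.J (2 * n - 2) k : ℤ) +
        (2 * (k - 1) * (2 * (n : ℤ) - k) + 1) * (SignedInvolution.J (2 * n - 2) (k - 1) : ℤ) +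
        ((k - 2) * (k - 4 * (n : ℤ)) + 4 * (n : ℤ) ^ 2 - 3 * (n : ℤ)) *
          (SignedInvolution.J (2 * n - 2) (k - 2) : ℤ)) ∧
    SignedInvolution.J 2 0 = 0 ∧ SignedInvolution.J 2 1 = 1 ∧ SignedInvolution.J 2 2 = 1 ∧
    (∀ (n : ℕ) (k : ℤ), 1 ≤ n → k < 0 → SignedInvolution.J (2 * n) k = 0) := by
  -- For `n = 1` the right-hand side is `m²`; the cases `m = 0, 1, 2` determine the three initial
  -- values.
  have h0 := SignedInvolution.sum_J_mul_choose le_rfl 0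
  have h1 := SignedInvolution.sum_J_mul_choose le_rfl 1
  have h2 := SignedInvolution.sum_J_mul_choose le_rfl 2
  simp [Finset.sum_range_succ, Nat.choose] at h0 h1 h2
  refine ⟨fun n k hn hk => ?_, by omega, by omega, by omega,
    fun n k _ hk => SignedInvolution.J_neg _ hk⟩
  lift k to ℕ using hk
  exact SignedInvolution.J_recurrence n k hn
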